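/- Let $q$ be a complex number with $0<|q|<1$. Write $(a)_\infty=(a;q)_\infty:=\prod_{k\ge 1}(1-aq^{k-1})$, $\Theta(x;q):=(x)_\infty(q/x)_\infty(q)_\infty$, $\binom{n}{2}:=\frac{n(n-1)}{2}$ for $n\in\mathbb{Z}$, and $\mathrm{sg}(r,s):=\frac{\mathrm{sg}(r)+\mathrm{sg}(s)}{2}$, where $\mathrm{sg}(r)=1$ if $r\ge 0$ and $\mathrm{sg}(r)=-1$ if $r<0$. For positive integers $a,b,c$ and non-zero $x,y$ let $$f_{a,b,c}(x,y;q):=\sum_{r,s\in\mathbb{Z}}\mathrm{sg}(r,s)(-1)^{r+s}x^ry^sq^{a\binom r2+brs+c\binom s2}.$$ For integers $t\ge 1$ and $1-t\le m\le t$ let $$h_{t,m}(x;q):=\Bigl(\sum_{r,s\ge 0}-\sum_{r,s<0}\Bigr)\frac{(-1)^{r+s}q^{\binom{r+1}{2}+2trs+\binom{s+1}{2}+(t-m)r}(1+q^{2mr})}{1-xq^r},$$ $$W_t^{(m)}(x;q):=\frac{1-x}{(q)_\infty^2}\,h_{t,m}(x;q)-\frac{1}{(xq)_\infty(q/x)_\infty}.$$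 Theorem. Let $t,m$ be integers with $t\ge 1$ and $1-t\le m\le t$, and let $x$ be a non-zero complex number that is not an integral power of $q$. Then the double series defining $h_{t,m}(x;q)$ and the double sums $f$ below converge absolutely, and $$\begin{aligned}W_t^{(m)}(x;q)={}&\frac{(1-x)q^{1-m-2t^2}}{(q)_\infty^2}\sum_{k=0}^{4t^2-2}(-1)^{k+1}q^{\binom{k+1}{2}+k}f_{1,2t,1}(q^{t-m+2-4t^2+k},q;q)\\&\times\Bigl(\frac{1}{\Theta(x;q)}f_{1,4t^2-1,4t^2(4t^2-1)}(x^{-1}q^{k+1},-q^{8t^4-m+4t^2k};q)\\&\qquad-\frac{x^{-1}}{\Theta(x^{-1};q)}f_{1,4t^2-1,4t^2(4t^2-1)}(xq^{k+1},-q^{8t^4-m+4t^2k};q)\Bigr)\\&-\frac{1}{(xq)_\infty(q/x)_\infty}.\end{aligned}$$ -/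

import Mathlib

noncomputable section

namespace MixedFalseTheta

/-- The infinite `q`-Pochhammer symbol `(a)_∞ = (a; q)_∞ = ∏_{k ≥ 1} (1 - a q^(k-1))`. -/
def qPochInf (a q : ℂ) : ℂ := ∏' k : ℕ, (1 - a * q ^ k)

/-- For `|q| < 1` the product defining `(a; q)_∞` converges. -/
theorem multipliable_qPochInf (a : ℂ) {q : ℂ} (hq : ‖q‖ < 1) :
    Multipliable (fun k : ℕ => 1 - a * q ^ k) := by
  have h : Summable (fun k : ℕ => ‖-(a * q ^ k)‖) := by
    simp only [norm_neg, norm_mul, norm_pow]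
    exact (summable_geometric_of_lt_one (norm_nonneg q) hq).mul_left _
  simpa only [sub_eq_add_neg] using multipliable_one_add_of_summable h

/-- The theta function `Θ(x; q) = (x)_∞ (q/x)_∞ (q)_∞`. -/
def Theta (x q : ℂ) : ℂ := qPochInf x q * qPochInf (q / x) q * qPochInf q q

/-- The binomial coefficient `n (n - 1) / 2` of an arbitrary integer `n`. -/
def binom2 (n : ℤ) : ℤ := n * (n - 1) / 2

/-- The division in `binom2` is exact. -/
theorem two_mul_binom2 (n : ℤ) : 2 * binom2 n = n * (n - 1) :=
  Int.mul_ediv_cancel' (Int.even_mul_pred_self n).two_dvd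

/-- `sg(r) = 1` if `r ≥ 0`, and `sg(r) = -1` if `r < 0`. -/
def sg (r : ℤ) : ℤ := if 0 ≤ r then 1 else -1

/-- `sg(r, s) = (sg(r) + sg(s)) / 2`. -/
def sg₂ (r s : ℤ) : ℤ := (sg r + sg s) / 2

/-- `∑_{r,s} sg(r,s) F(r,s)` is `∑_{r,s ≥ 0} F(r,s) - ∑_{r,s < 0} F(r,s)`. -/
theorem sg₂_eq (r s : ℤ) :
    sg₂ r s = if 0 ≤ r ∧ 0 ≤ s then 1 else if r < 0 ∧ s < 0 then -1 else 0 := by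
  unfold sg₂ sg
  split_ifs <;> first | rfl | omega

/-- The general term, indexed by `p = (r, s)`, of the Hecke-type double sum
`f_{a,b,c}(x, y; q)`. -/
def heckeTerm (a b c : ℤ) (x y q : ℂ) (p : ℤ × ℤ) : ℂ :=
  (sg₂ p.1 p.2 : ℂ) * (-1) ^ (p.1 + p.2) * x ^ p.1 * y ^ p.2 *
    q ^ (a * binom2 p.1 + b * p.1 * p.2 + c * binom2 p.2)

/-- The Hecke-type double sum
`f_{a,b,c}(x, y; q) = ∑_{r,s ∈ ℤ} sg(r,s) (-1)^(r+s) x^r y^s q^(a C(r,2) + b r s + c C(s,2))`. -/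
def heckeSum (a b c : ℤ) (x y q : ℂ) : ℂ := ∑' p : ℤ × ℤ, heckeTerm a b c x y q p

/-- The general term, indexed by `p = (r, s)`, of the Hecke-Appell type double sum
`h_{t,m}(x; q)`. -/
def hTerm (t m : ℤ) (x q : ℂ) (p : ℤ × ℤ) : ℂ :=
  (sg₂ p.1 p.2 : ℂ) *
    ((-1) ^ (p.1 + p.2) *
      q ^ (binom2 (p.1 + 1) + 2 * t * p.1 * p.2 + binom2 (p.2 + 1) + (t - m) * p.1) *
      (1 + q ^ (2 * m * p.1)) / (1 - x * q ^ p.1))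

/-- The double sum `h_{t,m}(x; q) = (∑_{r,s ≥ 0} - ∑_{r,s < 0}) (-1)^(r+s)
q^(C(r+1,2) + 2 t r s + C(s+1,2) + (t-m) r) (1 + q^(2 m r)) / (1 - x q^r)`. -/
def hSum (t m : ℤ) (x q : ℂ) : ℂ := ∑' p : ℤ × ℤ, hTerm t m x q p

/-- `W_t^{(m)}(x; q) = (1 - x) / (q)_∞² · h_{t,m}(x; q) - 1 / ((xq)_∞ (q/x)_∞)`. -/
def W (t m : ℤ) (x q : ℂ) : ℂ :=
  (1 - x) / qPochInf q q ^ 2 * hSum t m x q -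
    1 / (qPochInf (x * q) q * qPochInf (q / x) q)

end MixedFalseTheta

end

/-!
Write `θ(z) = ∑ (-1)^n q^(n(n-1)/2) z^n`. By Jacobi's triple product (`theta_eq_thetaSum`) this is
`Θ(z; q)`, and it vanishes at every integral power of `q` (`thetaSum_zpow`). After
`Θ(x⁻¹; q) = -x⁻¹ Θ(x; q)` the theorem is an identity between `Θ(x; q) h_{t,m}(x; q)` and a Laurent
series in `x` which is symmetric under `x ↦ x⁻¹`.

Since `θ(q^v) = 0`, summing over `s` turns `h_{t,m}` into two single sums over `r` of theta terms
times `p(r) / (1 - x q^r)`, where `p` is a partial theta series (`partialTheta`, `hSum_eq`). The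
factor `Θ(x; q) / (1 - x q^r)` is itself the double sum `f_{1,1,1}(q/x, q^(r+1); q)`
(`heckeSum_one_one_one_zpow`), because `f_{1,1,1}` is a divided difference of `z θ(z)`. This gives an
absolutely convergent triple series (`summable_triple`; the range `1 - t ≤ m ≤ t` is what makes it
converge). Summing it over `r` first gives
`∑_{n,i} sg(n,i) (-1)^(n+i) x^(∓n) q^((n+i+1)(n+i)/2) G(t - m + i)`
with `G(u) = f_{1,2t,1}(q^(1+u), q; q)` (`rowSum`); the sign `-` corresponds to one half of `h_{t,m}`
and the sign `+` to the other, which the substitution `x ↦ x⁻¹`, `r ↦ -r` exchanges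
(`thetaSum_mul_hSum`).

Finally `G(u + 4t² - 1)` is an explicit multiple of `G(u)` (`rowSum_add`): shifting `(r, s)` to
`(r + 1, s - 2t)` produces boundary terms that are theta series at powers of `q`, hence zero. Writing
`i = k + (4t² - 1) s` with `0 ≤ k ≤ 4t² - 2` thus takes `G` out of the sum over `n` and `s`, and what
remains is `f_{1,4t²-1,4t²(4t²-1)}` (`tsum_heckeTerm_mul_rowSum_eq_sum`).
-/

open Filter Topology

namespace MixedFalseTheta

/-! ### Generalized binomial coefficients and theta series -/

theorem binom2_add (m n : ℤ) : binom2 (m + n) = binom2 m + binom2 n + m * n := by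
  linarith [two_mul_binom2 (m + n), two_mul_binom2 m, two_mul_binom2 n]

theorem binom2_add_one (n : ℤ) : binom2 (n + 1) = binom2 n + n := by
  linarith [two_mul_binom2 (n + 1), two_mul_binom2 n]

theorem binom2_neg (n : ℤ) : binom2 (-n) = binom2 n + n := by
  linarith [two_mul_binom2 (-n), two_mul_binom2 n]

theorem binom2_nonneg (n : ℤ) : 0 ≤ binom2 n := by
  have h := two_mul_binom2 n
  have : 0 ≤ n * (n - 1) := by
    rcases le_or_gt n 0 with h | h
    · exact mul_nonneg_of_nonpos_of_nonpos h (by omega)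
    · exact mul_nonneg h.le (by omega)
  omega

/-- The general term of the bilateral theta series `∑ (-1)^n z^n q^(n(n-1)/2)`. -/
noncomputable def thetaTerm (z q : ℂ) (n : ℤ) : ℂ := (-1) ^ n * z ^ n * q ^ binom2 n

/-- The bilateral theta series `∑ (-1)^n z^n q^(n(n-1)/2)`. -/
noncomputable def thetaSum (z q : ℂ) : ℂ := ∑' n : ℤ, thetaTerm z q n

theorem norm_neg_one_zpow (n : ℤ) : ‖(-1 : ℂ) ^ n‖ = 1 := by simp

theorem summable_thetaTerm_nat {z q : ℂ} (hq0 : q ≠ 0) (hq1 : ‖q‖ < 1) (hz : z ≠ 0) :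
    Summable fun n : ℕ => thetaTerm z q n := by
  refine summable_of_ratio_test_tendsto_lt_one (l := 0) one_pos (.of_forall fun n => ?_) ?_
  · simp [thetaTerm, hz, hq0, zpow_ne_zero]
  · have h : Tendsto (fun n : ℕ => ‖z‖ * ‖q‖ ^ n) atTop (𝓝 0) := by
      simpa using (tendsto_pow_atTop_nhds_zero_of_lt_one (norm_nonneg q) hq1).const_mul ‖z‖
    refine h.congr fun n => ?_
    have hz' : ‖z‖ ≠ 0 := norm_ne_zero_iff.2 hz
    have hq' : ‖q‖ ≠ 0 := norm_ne_zero_iff.2 hq0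
    simp only [thetaTerm, norm_mul, norm_zpow, norm_pow, norm_neg, norm_one, one_zpow, one_pow,
      one_mul, Nat.cast_add, Nat.cast_one, binom2_add_one, zpow_add₀ hz', zpow_add₀ hq', zpow_one,
      zpow_natCast]
    have := zpow_ne_zero (binom2 n) hq'
    field_simp

theorem summable_thetaTerm {z q : ℂ} (hq0 : q ≠ 0) (hq1 : ‖q‖ < 1) (hz : z ≠ 0) :
    Summable (thetaTerm z q) := by
  refine .of_nat_of_neg (summable_thetaTerm_nat hq0 hq1 hz) ?_
  refine (summable_thetaTerm_nat hq0 hq1 (div_ne_zero hq0 hz)).congr fun n => ?_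
  simp only [thetaTerm, binom2_neg, zpow_add₀ hq0, div_zpow, zpow_neg]
  rw [← inv_zpow, inv_neg_one]
  field_simp

/-- The theta series vanishes at the integral powers of `q`: the reflection `n ↦ 1 - 2v - n`
changes the sign of its terms. -/
theorem thetaSum_zpow {q : ℂ} (hq0 : q ≠ 0) (v : ℤ) : thetaSum (q ^ v) q = 0 := by
  have h : thetaSum (q ^ v) q = -thetaSum (q ^ v) q := by
    conv_lhs => rw [thetaSum, ← (Equiv.subLeft (1 - 2 * v)).tsum_eq]
    rw [thetaSum, ← tsum_neg]
    congr 1 with n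
    simp only [thetaTerm, Equiv.subLeft_apply, ← zpow_mul]
    rw [mul_assoc, mul_assoc, ← zpow_add₀ hq0, ← zpow_add₀ hq0, ← neg_mul]
    congr 1
    · rw [show 1 - 2 * v - n = 1 + 2 * -v + -n by ring, zpow_add₀ (by simp), zpow_add₀ (by simp),
        zpow_mul, zpow_neg (-1) n, ← inv_zpow, inv_neg_one]
      simp
    · congr 1
      linarith [two_mul_binom2 n, two_mul_binom2 (1 - 2 * v - n)]
  exact self_eq_neg.1 h

theorem hasSum_thetaTerm {z q : ℂ} (hq0 : q ≠ 0) (hq1 : ‖q‖ < 1) (hz : z ≠ 0) :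
    HasSum (thetaTerm z q) (thetaSum z q) :=
  (summable_thetaTerm hq0 hq1 hz).hasSum

theorem hasSum_thetaTerm_zpow {q : ℂ} (hq0 : q ≠ 0) (hq1 : ‖q‖ < 1) (v : ℤ) :
    HasSum (thetaTerm (q ^ v) q) 0 :=
  thetaSum_zpow hq0 v ▸ hasSum_thetaTerm hq0 hq1 (zpow_ne_zero v hq0)

theorem thetaSum_mul_q {z q : ℂ} (hq0 : q ≠ 0) (hz : z ≠ 0) :
    thetaSum (z * q) q = -z⁻¹ * thetaSum z q := by
  rw [thetaSum, thetaSum, ← (Equiv.addRight (1 : ℤ)).tsum_eq (thetaTerm z q), ← tsum_mul_left]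
  congr 1 with n
  simp only [thetaTerm, Equiv.coe_addRight, binom2_add_one, mul_zpow, zpow_add₀ hq0, zpow_add₀ hz,
    zpow_add₀ (show (-1 : ℂ) ≠ 0 by simp), zpow_one]
  field_simp

/-! ### Jacobi's triple product -/

theorem qPochInf_eq_mul {q : ℂ} (hq1 : ‖q‖ < 1) (a : ℂ) :
    qPochInf a q = (1 - a) * qPochInf (a * q) q := by
  rw [qPochInf, qPochInf, tprod_eq_zero_mul' ]
  · simp [pow_succ, mul_assoc, mul_comm q]
  · simpa [pow_succ, mul_assoc, mul_comm q] using multipliable_qPochInf (a * q) hq1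

theorem qPochInf_ne_zero {a q : ℂ} (hq1 : ‖q‖ < 1) (ha : ∀ n : ℕ, a * q ^ n ≠ 1) :
    qPochInf a q ≠ 0 := by
  have h : Summable fun k : ℕ => ‖-(a * q ^ k)‖ := by
    simp only [norm_neg, norm_mul, norm_pow]
    exact (summable_geometric_of_lt_one (norm_nonneg q) hq1).mul_left _
  have := tprod_one_add_ne_zero_of_summable (f := fun k : ℕ => -(a * q ^ k))
    (fun k => by rw [← sub_eq_add_neg]; exact sub_ne_zero.2 (ha k).symm) h
  simpa only [qPochInf, sub_eq_add_neg] using this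

theorem tendsto_prod_qPochInf {q : ℂ} (hq1 : ‖q‖ < 1) (a : ℂ) :
    Tendsto (fun n => ∏ k ∈ Finset.range n, (1 - a * q ^ k)) atTop (𝓝 (qPochInf a q)) :=
  (multipliable_qPochInf a hq1).hasProd.tendsto_prod_nat

theorem prod_mul_qPochInf {q : ℂ} (hq1 : ‖q‖ < 1) (a : ℂ) (n : ℕ) :
    (∏ k ∈ Finset.range n, (1 - a * q ^ k)) * qPochInf (a * q ^ n) q = qPochInf a q := by
  induction n with
  | zero => simp
  | succ n ih =>
    rw [← ih, Finset.prod_range_succ, qPochInf_eq_mul hq1 (a * q ^ n), pow_succ, mul_assoc,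
      mul_assoc a]

theorem pow_ne_one_of_norm_lt {q : ℂ} (hq1 : ‖q‖ < 1) (n : ℕ) : q * q ^ n ≠ 1 := by
  intro h
  have h2 := congrArg norm h
  rw [← pow_succ', norm_pow, norm_one] at h2
  exact (pow_lt_one₀ (norm_nonneg q) hq1 n.succ_ne_zero).ne h2

theorem qPochInf_self_ne_zero {q : ℂ} (hq1 : ‖q‖ < 1) : qPochInf q q ≠ 0 :=
  qPochInf_ne_zero hq1 (pow_ne_one_of_norm_lt hq1)

/-- The tail `(q^(k+1); q)_∞`, equal to `(q)_∞ / (q)_k` for `k ≥ 0` and to `0` for `k < 0`. -/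
noncomputable def qTail (q : ℂ) (k : ℤ) : ℂ := qPochInf (q ^ (k + 1)) q

theorem qTail_sub_one {q : ℂ} (hq0 : q ≠ 0) (hq1 : ‖q‖ < 1) (k : ℤ) :
    qTail q (k - 1) = (1 - q ^ k) * qTail q k := by
  rw [qTail, qTail, qPochInf_eq_mul hq1, sub_add_cancel, zpow_add_one₀ hq0]

theorem qTail_of_neg {q : ℂ} (hq0 : q ≠ 0) (hq1 : ‖q‖ < 1) {k : ℤ} (hk : k < 0) :
    qTail q k = 0 := by
  obtain ⟨n, hn⟩ := Int.eq_ofNat_of_zero_le (show 0 ≤ -(k + 1) by omega)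
  rw [qTail, ← prod_mul_qPochInf hq1 _ (n + 1), Finset.prod_range_succ, ← zpow_natCast q n,
    ← zpow_add₀ hq0, show k + 1 + (n : ℤ) = 0 by omega]
  simp

theorem tendsto_qTail {q : ℂ} (hq1 : ‖q‖ < 1) :
    Tendsto (fun n : ℕ => qTail q n) atTop (𝓝 1) := by
  have h0 := qPochInf_self_ne_zero hq1
  have h := (tendsto_prod_qPochInf hq1 q).inv₀ h0 |>.const_mul (qPochInf q q)
  rw [mul_inv_cancel₀ h0] at h
  refine h.congr fun n => ?_
  have h1 := prod_mul_qPochInf hq1 q n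
  have h2 : ∏ k ∈ Finset.range n, (1 - q * q ^ k) ≠ 0 := fun h => by simp [h] at h1; exact h0 h1.symm
  rw [mul_inv_eq_iff_eq_mul₀ h2, ← h1, qTail, ← Nat.cast_add_one, zpow_natCast, pow_succ', mul_comm]

theorem exists_norm_qTail_le {q : ℂ} (hq0 : q ≠ 0) (hq1 : ‖q‖ < 1) :
    ∃ C, ∀ k, ‖qTail q k‖ ≤ C := by
  obtain ⟨C, hC⟩ := (tendsto_qTail hq1).norm.bddAbove_range
  refine ⟨C, fun k => ?_⟩
  have hC' : ∀ n : ℕ, ‖qTail q n‖ ≤ C := fun n => hC ⟨n, rfl⟩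
  rcases lt_or_ge k 0 with h | h
  · rw [qTail_of_neg hq0 hq1 h, norm_zero]
    exact (norm_nonneg _).trans (hC' 0)
  · lift k to ℕ using h
    exact hC' k

theorem summable_thetaTerm_mul_qTail {x q : ℂ} (hq0 : q ≠ 0) (hq1 : ‖q‖ < 1) (hx : x ≠ 0) (n : ℤ) :
    Summable fun j => thetaTerm x q j * (qTail q (n + j) * qTail q (n - j)) := by
  obtain ⟨C, hC⟩ := exists_norm_qTail_le hq0 hq1
  have hC0 : 0 ≤ C := (norm_nonneg _).trans (hC 0)
  refine .of_norm_bounded ((summable_thetaTerm hq0 hq1 hx).norm.mul_right (C * C)) fun j => ?_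
  rw [norm_mul, norm_mul]
  gcongr <;> exact hC _

/-- The finite form of Jacobi's triple product identity. The `q`-binomial coefficients
`(q)_{2n} / ((q)_{n+j} (q)_{n-j})` are written with tails of `(q)_∞`, which vanish by themselves
outside `-n ≤ j ≤ n`. -/
theorem prod_mul_prod_eq_tsum {x q : ℂ} (hq0 : q ≠ 0) (hq1 : ‖q‖ < 1) (hx : x ≠ 0) (n : ℕ) :
    (∏ k ∈ Finset.range n, (1 - x * q ^ k)) * (∏ k ∈ Finset.range n, (1 - q / x * q ^ k)) *
        qPochInf q q ^ 2 =
      (∏ k ∈ Finset.range (2 * n), (1 - q * q ^ k)) *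
        ∑' j : ℤ, thetaTerm x q j * (qTail q (n + j) * qTail q (n - j)) := by
  induction n with
  | zero =>
    rw [tsum_eq_single 0]
    · simp [thetaTerm, qTail, binom2, sq]
    · intro j hj
      rcases lt_or_gt_of_ne hj with h | h
      · rw [qTail_of_neg hq0 hq1 (k := ((0 : ℕ) : ℤ) + j) (by simpa using h)]; simp
      · rw [qTail_of_neg hq0 hq1 (k := ((0 : ℕ) : ℤ) - j) (by simpa using h)]; simp
  | succ n ih =>
    set B : ℤ → ℂ := fun j => qTail q (n + j) * qTail q (n - j) with hB
    have hs := summable_thetaTerm_mul_qTail hq0 hq1 hx n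
    -- multiplication of the series by `x` and by `x⁻¹`, as a shift of the index
    have hs1 : ∑' j, x * (thetaTerm x q (j - 1) * B (j - 1)) =
        x * ∑' j, thetaTerm x q j * B j := by
      rw [tsum_mul_left]
      congr 1
      exact (Equiv.subRight (1 : ℤ)).tsum_eq fun j => thetaTerm x q j * B j
    have hs2 : ∑' j, x⁻¹ * (thetaTerm x q (j + 1) * B (j + 1)) =
        x⁻¹ * ∑' j, thetaTerm x q j * B j := by
      rw [tsum_mul_left]
      congr 1
      exact (Equiv.addRight (1 : ℤ)).tsum_eq fun j => thetaTerm x q j * B j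
    have hS1 : Summable fun j => x * (thetaTerm x q (j - 1) * B (j - 1)) :=
      ((Equiv.subRight (1 : ℤ)).summable_iff.2 hs).mul_left x
    have hS2 : Summable fun j => x⁻¹ * (thetaTerm x q (j + 1) * B (j + 1)) :=
      ((Equiv.addRight (1 : ℤ)).summable_iff.2 hs).mul_left x⁻¹
    have key : (1 - x * q ^ n) * (1 - q / x * q ^ n) * ∑' j, thetaTerm x q j * B j =
        (1 - q * q ^ (2 * n)) * (1 - q * q ^ (2 * n + 1)) *
          ∑' j, thetaTerm x q j * (qTail q ((n + 1 : ℕ) + j) * qTail q ((n + 1 : ℕ) - j)) := by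
      calc _ = (1 + q ^ (2 * n + 1)) * ∑' j, thetaTerm x q j * B j -
            q ^ n * (x * ∑' j, thetaTerm x q j * B j) -
            q ^ (n + 1) * (x⁻¹ * ∑' j, thetaTerm x q j * B j) := by
              field_simp
              ring
        _ = _ := by
          rw [← hs1, ← hs2, ← tsum_mul_left, ← tsum_mul_left, ← tsum_mul_left, ← tsum_mul_left,
            ← (hs.mul_left _).tsum_sub (hS1.mul_left _),
            ← ((hs.mul_left _).sub (hS1.mul_left _)).tsum_sub (hS2.mul_left _)]
          congr 1 with j
          have e1 : qTail q (n + j) = (1 - q ^ (n + 1 + j)) * qTail q (n + 1 + j) := by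
            rw [← qTail_sub_one hq0 hq1]; congr 1; ring
          have e2 : qTail q (n - j) = (1 - q ^ (n + 1 - j)) * qTail q (n + 1 - j) := by
            rw [← qTail_sub_one hq0 hq1]; congr 1; ring
          have e3 : qTail q (n + (j - 1)) = (1 - q ^ (n + j)) * qTail q (n + j) := by
            rw [← qTail_sub_one hq0 hq1]; congr 1; ring
          have e4 : qTail q (n - (j + 1)) = (1 - q ^ (n - j)) * qTail q (n - j) := by
            rw [← qTail_sub_one hq0 hq1]; congr 1; ring
          have e5 : qTail q (n - (j - 1)) = qTail q (n + 1 - j) := by congr 1; ring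
          have e6 : qTail q (n + (j + 1)) = qTail q (n + 1 + j) := by congr 1; ring
          simp only [hB, e3, e4, e5, e6]
          rw [e1, e2]
          push_cast
          have t1 : thetaTerm x q j = (-1) ^ j * x ^ j * q ^ binom2 j := rfl
          have t2 : thetaTerm x q (j - 1) = -(thetaTerm x q j * x⁻¹ * q * (q ^ j)⁻¹) := by
            rw [thetaTerm, thetaTerm, show binom2 (j - 1) = binom2 j + 1 + -j by
              linarith [two_mul_binom2 j, two_mul_binom2 (j - 1)], zpow_sub₀ hx,
              zpow_sub₀ (by simp), zpow_add₀ hq0, zpow_add₀ hq0, zpow_neg]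
            simp
            field_simp
          have t3 : thetaTerm x q (j + 1) = -(thetaTerm x q j * x * q ^ j) := by
            rw [thetaTerm, thetaTerm, binom2_add_one, zpow_add₀ hx,
              zpow_add₀ (by simp), zpow_add₀ hq0]
            simp
            ring
          rw [t2, t3]
          simp only [zpow_add₀ hq0, zpow_sub₀ hq0, zpow_natCast, zpow_one]
          have hj := zpow_ne_zero j hq0
          field_simp
          ring
    rw [Finset.prod_range_succ, Finset.prod_range_succ, show 2 * (n + 1) = 2 * n + 1 + 1 by ring,
      Finset.prod_range_succ, Finset.prod_range_succ]
    linear_combination (1 - x * q ^ n) * (1 - q / x * q ^ n) * ih +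
      (∏ k ∈ Finset.range (2 * n), (1 - q * q ^ k)) * key

/-- Jacobi's triple product identity. -/
theorem theta_eq_thetaSum {x q : ℂ} (hq0 : q ≠ 0) (hq1 : ‖q‖ < 1) (hx : x ≠ 0) :
    Theta x q = thetaSum x q := by
  obtain ⟨C, hC⟩ := exists_norm_qTail_le hq0 hq1
  have hC0 : 0 ≤ C := (norm_nonneg _).trans (hC 0)
  have tendsto_toNat : Tendsto Int.toNat atTop atTop :=
    tendsto_atTop_atTop.2 fun b => ⟨b, fun a ha => by omega⟩
  have htail : ∀ f : ℕ → ℤ, Tendsto f atTop atTop →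
      Tendsto (fun n => qTail q (f n)) atTop (𝓝 1) := by
    intro f hf
    have h := (tendsto_qTail hq1).comp (tendsto_toNat.comp hf)
    refine h.congr' ?_
    filter_upwards [hf.eventually_ge_atTop 0] with n hn
    simp [Int.toNat_of_nonneg hn]
  have h1 : Tendsto (fun n : ℕ => ∑' j : ℤ,
      thetaTerm x q j * (qTail q (n + j) * qTail q (n - j))) atTop (𝓝 (thetaSum x q)) := by
    refine tendsto_tsum_of_dominated_convergence
      ((summable_thetaTerm hq0 hq1 hx).norm.mul_right (C * C)) (fun j => ?_)
      (.of_forall fun n j => ?_)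
    · have a := htail (fun n => (n : ℤ) + j)
        (tendsto_atTop_add_const_right _ _ tendsto_natCast_atTop_atTop)
      have b := htail (fun n => (n : ℤ) - j)
        (tendsto_atTop_add_const_right _ _ tendsto_natCast_atTop_atTop)
      simpa using (a.mul b).const_mul (thetaTerm x q j)
    · rw [norm_mul, norm_mul]
      gcongr <;> exact hC _
  have h2 := ((tendsto_prod_qPochInf hq1 q).comp
    (tendsto_id.const_mul_atTop' (show 0 < 2 by norm_num))).mul h1
  have h3 := ((tendsto_prod_qPochInf hq1 x).mul (tendsto_prod_qPochInf hq1 (q / x))).mul_const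
    (qPochInf q q ^ 2)
  have h := tendsto_nhds_unique h3 (h2.congr fun n => (prod_mul_prod_eq_tsum hq0 hq1 hx n).symm)
  have h0 := qPochInf_self_ne_zero hq1
  rw [Theta]
  apply mul_left_cancel₀ h0
  linear_combination h

theorem theta_ne_zero {x q : ℂ} (hq0 : q ≠ 0) (hq1 : ‖q‖ < 1) (hx0 : x ≠ 0)
    (hx : ∀ n : ℤ, x ≠ q ^ n) : Theta x q ≠ 0 := by
  refine mul_ne_zero (mul_ne_zero (qPochInf_ne_zero hq1 fun n h => hx (-n) ?_)
    (qPochInf_ne_zero hq1 fun n h => hx (n + 1) ?_)) (qPochInf_self_ne_zero hq1)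
  · rw [zpow_neg, zpow_natCast]
    exact eq_inv_of_mul_eq_one_left h
  · rw [zpow_add₀ hq0, zpow_natCast, zpow_one, ← mul_one x, ← h]
    field_simp

theorem thetaSum_inv {x q : ℂ} (hq0 : q ≠ 0) (hx : x ≠ 0) :
    thetaSum x⁻¹ q = -x⁻¹ * thetaSum x q := by
  rw [thetaSum, thetaSum, ← (Equiv.subLeft (1 : ℤ)).tsum_eq (thetaTerm x q), ← tsum_mul_left]
  congr 1 with n
  simp only [thetaTerm, Equiv.subLeft_apply, show binom2 (1 - n) = binom2 n by
    linarith [two_mul_binom2 (1 - n), two_mul_binom2 n], inv_zpow, zpow_sub₀ hx,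
    zpow_sub₀ (show (-1 : ℂ) ≠ 0 by simp), zpow_one]
  rw [div_eq_mul_inv (-1), ← inv_zpow (-1), inv_neg_one]
  field_simp

/-! ### Hecke-type double sums and `f_{1,1,1}` -/

/-- On the support of `sg(r, s)` the mixed term of the exponent is nonnegative, so the double sum is
dominated by a product of two theta series. -/
theorem norm_heckeTerm_le {a b c : ℤ} (ha : 1 ≤ a) (hb : 0 ≤ b) (hc : 1 ≤ c) {x y q : ℂ}
    (hq0 : q ≠ 0) (hq1 : ‖q‖ < 1) (p : ℤ × ℤ) :
    ‖heckeTerm a b c x y q p‖ ≤ ‖thetaTerm x q p.1‖ * ‖thetaTerm y q p.2‖ := by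
  obtain ⟨r, s⟩ := p
  have hq' : 0 < ‖q‖ := norm_pos_iff.2 hq0
  have key (hrs : 0 ≤ r * s) : ‖x‖ ^ r * ‖y‖ ^ s * ‖q‖ ^ (a * binom2 r + b * r * s + c * binom2 s) ≤
      ‖thetaTerm x q r‖ * ‖thetaTerm y q s‖ := by
    have h : ‖thetaTerm x q r‖ * ‖thetaTerm y q s‖ =
        ‖x‖ ^ r * ‖y‖ ^ s * ‖q‖ ^ (binom2 r + binom2 s) := by
      simp only [thetaTerm, norm_mul, norm_zpow, norm_neg, norm_one, one_zpow,
        zpow_add₀ hq'.ne']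
      ring
    rw [h]
    refine mul_le_mul_of_nonneg_left (zpow_le_zpow_right_of_le_one₀ hq' hq1.le ?_) (by positivity)
    nlinarith [binom2_nonneg r, binom2_nonneg s, mul_nonneg hb hrs]
  simp only [heckeTerm, sg₂_eq, norm_mul, norm_zpow, norm_neg, norm_one, one_zpow]
  split_ifs with h1 h2
  · simpa using key (mul_nonneg h1.1 h1.2)
  · simpa using key (mul_nonneg_of_nonpos_of_nonpos h2.1.le h2.2.le)
  · simp only [Int.cast_zero, norm_zero, zero_mul]
    positivity

theorem summable_heckeTerm {a b c : ℤ} (ha : 1 ≤ a) (hb : 0 ≤ b) (hc : 1 ≤ c) {x y q : ℂ}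
    (hq0 : q ≠ 0) (hq1 : ‖q‖ < 1) (hx : x ≠ 0) (hy : y ≠ 0) :
    Summable (heckeTerm a b c x y q) :=
  .of_norm_bounded ((summable_thetaTerm hq0 hq1 hx).norm.mul_of_nonneg
    (summable_thetaTerm hq0 hq1 hy).norm (fun _ => norm_nonneg _) fun _ => norm_nonneg _)
    (norm_heckeTerm_le ha hb hc hq0 hq1)

theorem heckeTerm_one_one_one {x y q : ℂ} (hq0 : q ≠ 0) (n i : ℤ) :
    heckeTerm 1 1 1 x y q (n, i) =
      sg₂ n i * ((-1) ^ (n + i) * x ^ n * y ^ i * q ^ binom2 (n + i)) := by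
  simp only [heckeTerm, binom2_add, one_mul, zpow_add₀ hq0]
  ring

/-- The double sum `f_{1,1,1}` is a divided difference of the theta series: shifting `(n, i)` to
`(n - 1, i + 1)` telescopes all but the lines `n = 0` and `i = -1`. -/
theorem sub_mul_heckeSum_one_one_one {x y q : ℂ} (hq0 : q ≠ 0) (hq1 : ‖q‖ < 1)
    (hx : x ≠ 0) (hy : y ≠ 0) :
    (y - x) * heckeSum 1 1 1 x y q = y * thetaSum y q - x * thetaSum x q := by
  have hs := summable_heckeTerm (a := 1) (b := 1) (c := 1) le_rfl zero_le_one le_rfl hq0 hq1 hx hy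
  let e : ℤ × ℤ ≃ ℤ × ℤ := (Equiv.subRight (1 : ℤ)).prodCongr (Equiv.addRight (1 : ℤ))
  have h1 : HasSum (fun p => y * heckeTerm 1 1 1 x y q p - x * heckeTerm 1 1 1 x y q (e p))
      (y * heckeSum 1 1 1 x y q - x * heckeSum 1 1 1 x y q) :=
    (hs.hasSum.mul_left y).sub ((e.hasSum_iff.2 hs.hasSum).mul_left x)
  have h2 : HasSum (fun p : ℤ × ℤ => if p.1 = 0 then y * thetaTerm y q p.2 else 0)
      (y * thetaSum y q) := by
    refine (Function.Injective.hasSum_iff (g := fun i : ℤ => ((0 : ℤ), i))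
      (fun i j h => (Prod.ext_iff.1 h).2) fun p hp => if_neg fun h => hp ⟨p.2, ?_⟩).1 ?_
    · exact Prod.ext h.symm rfl
    · exact ((hasSum_thetaTerm hq0 hq1 hy).mul_left y).congr_fun fun i => by simp
  have h3 : HasSum (fun p : ℤ × ℤ => if p.2 = -1 then x * thetaTerm x q (p.1 - 1) else 0)
      (x * thetaSum x q) := by
    refine (Function.Injective.hasSum_iff (g := fun i : ℤ => (i, (-1 : ℤ)))
      (fun i j h => (Prod.ext_iff.1 h).1) fun p hp => if_neg fun h => hp ⟨p.1, ?_⟩).1 ?_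
    · exact Prod.ext rfl h.symm
    · exact (((Equiv.subRight (1 : ℤ)).hasSum_iff.2
        (hasSum_thetaTerm hq0 hq1 hx)).mul_left x).congr_fun fun i => by simp
  rw [sub_mul]
  refine h1.unique ((h2.sub h3).congr_fun ?_)
  rintro ⟨n, i⟩
  have hn : x ^ n = x ^ (n - 1) * x := by rw [← zpow_add_one₀ hx, sub_add_cancel]
  have hsg : (sg₂ n i - sg₂ (n - 1) (i + 1) : ℂ) =
      (if n = 0 then 1 else 0) - if i = -1 then 1 else 0 := by
    simp only [sg₂_eq]
    split_ifs <;> first | omega | simp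
  have hK : y * heckeTerm 1 1 1 x y q (n, i) - x * heckeTerm 1 1 1 x y q (n - 1, i + 1) =
      (sg₂ n i - sg₂ (n - 1) (i + 1) : ℂ) *
        ((-1) ^ (n + i) * x ^ n * (y ^ i * y) * q ^ binom2 (n + i)) := by
    rw [heckeTerm_one_one_one hq0, heckeTerm_one_one_one hq0, hn, zpow_add_one₀ hy,
      show n - 1 + (i + 1) = n + i by ring]
    ring
  change y * heckeTerm 1 1 1 x y q (n, i) - x * heckeTerm 1 1 1 x y q (n - 1, i + 1) = _
  rw [hK, hsg, sub_mul]
  congr 1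
  · split_ifs with h
    · subst h; simp [thetaTerm]; ring
    · simp
  · split_ifs with h
    · subst h
      simp only [thetaTerm, ← sub_eq_add_neg, hn, zpow_neg_one]
      field_simp
    · simp

theorem one_sub_mul_zpow_ne_zero {x q : ℂ} (hx : ∀ n : ℤ, x ≠ q ^ n) (r : ℤ) :
    1 - x * q ^ r ≠ 0 := by
  rw [sub_ne_zero]
  intro h
  apply hx (-r)
  rw [zpow_neg]
  exact eq_inv_of_mul_eq_one_left h.symm

/-- The partial fraction kernel `Θ(x; q) / (1 - x q^r)` as a double sum. -/
theorem heckeSum_one_one_one_zpow {x q : ℂ} (hq0 : q ≠ 0) (hq1 : ‖q‖ < 1) (hx0 : x ≠ 0)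
    (hx : ∀ n : ℤ, x ≠ q ^ n) (r : ℤ) :
    heckeSum 1 1 1 (x⁻¹ * q) (q ^ (r + 1)) q = thetaSum x q / (1 - x * q ^ r) := by
  have h := sub_mul_heckeSum_one_one_one hq0 hq1 (mul_ne_zero (inv_ne_zero hx0) hq0)
    (zpow_ne_zero (r + 1) hq0)
  have h0 := one_sub_mul_zpow_ne_zero hx r
  rw [thetaSum_zpow hq0, thetaSum_mul_q hq0 (inv_ne_zero hx0), thetaSum_inv hq0 hx0,
    zpow_add_one₀ hq0] at h
  rw [eq_div_iff h0, zpow_add_one₀ hq0]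
  have e : (q ^ r * q - x⁻¹ * q) = -(x⁻¹ * q) * (1 - x * q ^ r) := by field_simp; ring
  rw [e] at h
  have h1 : x⁻¹ * q ≠ 0 := mul_ne_zero (inv_ne_zero hx0) hq0
  apply mul_left_cancel₀ (neg_ne_zero.2 h1)
  rw [inv_inv] at h
  have : x * x⁻¹ = 1 := mul_inv_cancel₀ hx0
  linear_combination h - x⁻¹ * q * thetaSum x q * this

/-! ### Partial theta series and the sums `f_{1,2t,1}` -/

theorem thetaTerm_zpow {q : ℂ} (hq0 : q ≠ 0) (v n : ℤ) :
    thetaTerm (q ^ v) q n = (-1) ^ n * q ^ (binom2 n + v * n) := by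
  rw [thetaTerm, ← zpow_mul, mul_assoc, ← zpow_add₀ hq0, add_comm]

/-- The partial theta series `∑_{s ≥ 0} (-1)^s q^(s(s+1)/2 + 2trs)`, written as a bilateral series
with vanishing terms for `s < 0`. -/
noncomputable def partialTheta (t : ℤ) (q : ℂ) (r : ℤ) : ℂ :=
  ∑' s : ℤ, if 0 ≤ s then thetaTerm (q ^ (1 + 2 * t * r)) q s else 0

theorem summable_thetaTerm_zpow {q : ℂ} (hq0 : q ≠ 0) (hq1 : ‖q‖ < 1) (v : ℤ) :
    Summable (thetaTerm (q ^ v) q) :=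
  summable_thetaTerm hq0 hq1 (zpow_ne_zero v hq0)

theorem summable_partialTheta {q : ℂ} (hq0 : q ≠ 0) (hq1 : ‖q‖ < 1) (v : ℤ) :
    Summable fun s : ℤ => if 0 ≤ s then thetaTerm (q ^ v) q s else 0 :=
  .of_norm_bounded (summable_thetaTerm_zpow hq0 hq1 v).norm fun s => by
    split_ifs
    · rfl
    · simp

/-- Since the full theta series vanishes, the sums over `s ≥ 0` and over `s < 0` differ by a
sign only. -/
theorem hasSum_sg_mul_thetaTerm {q : ℂ} (hq0 : q ≠ 0) (hq1 : ‖q‖ < 1) (t r : ℤ) :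
    HasSum (fun s => (sg₂ r s : ℂ) * thetaTerm (q ^ (1 + 2 * t * r)) q s) (partialTheta t q r) := by
  have h1 := (summable_partialTheta hq0 hq1 (1 + 2 * t * r)).hasSum
  have h2 := hasSum_thetaTerm_zpow hq0 hq1 (1 + 2 * t * r)
  have h3 := h1.sub (h2.mul_left (if r < 0 then 1 else 0))
  rw [mul_zero, sub_zero] at h3
  refine h3.congr_fun fun s => ?_
  simp only [sg₂_eq]
  split_ifs <;> first | omega | simp

/-- Reflection `s ↦ -1 - s`, which exchanges the sums over `s ≥ 0` and `s < 0`. -/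
theorem partialTheta_neg {q : ℂ} (hq0 : q ≠ 0) (hq1 : ‖q‖ < 1) (t r : ℤ) :
    partialTheta t q r = q ^ (-2 * t * r) * partialTheta t q (-r) := by
  have h1 := (summable_partialTheta hq0 hq1 (1 + 2 * t * -r)).hasSum.mul_left (q ^ (-2 * t * r))
  have h2 := hasSum_thetaTerm_zpow hq0 hq1 (1 + 2 * t * r)
  have h3 := h2.add ((Equiv.subLeft (-1 : ℤ)).hasSum_iff.2 h1)
  rw [zero_add] at h3
  refine (h3.congr_fun fun s => ?_).tsum_eq
  simp only [Function.comp_apply, Equiv.subLeft_apply, thetaTerm_zpow hq0]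
  rcases le_or_gt 0 s with h | h
  · rw [if_pos h, if_neg (by omega)]; ring
  · rw [if_neg (by omega), if_pos (by omega), mul_left_comm, ← zpow_add₀ hq0,
      show -2 * t * r + (binom2 (-1 - s) + (1 + 2 * t * -r) * (-1 - s)) =
        binom2 s + (1 + 2 * t * r) * s by
        linarith [two_mul_binom2 s, two_mul_binom2 (-1 - s)],
      zpow_sub₀ (show (-1 : ℂ) ≠ 0 by simp), div_eq_mul_inv, ← inv_zpow (-1) s, inv_neg_one]
    simp

/-- Splitting off the first `2t` terms leaves a multiple of the partial theta series for `r + 1`. -/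
theorem partialTheta_add_one {q : ℂ} (hq0 : q ≠ 0) (hq1 : ‖q‖ < 1) {t : ℤ} (ht : 1 ≤ t) (r : ℤ) :
    partialTheta t q r = ∑ s ∈ Finset.Ico 0 (2 * t), thetaTerm (q ^ (1 + 2 * t * r)) q s +
      q ^ (2 * t ^ 2 + t + 4 * t ^ 2 * r) * partialTheta t q (r + 1) := by
  have h1 := (summable_partialTheta hq0 hq1 (1 + 2 * t * (r + 1))).hasSum.mul_left
    (q ^ (2 * t ^ 2 + t + 4 * t ^ 2 * r))
  have h2 := hasSum_sum_of_ne_finset_zero (L := .unconditional ℤ) (s := Finset.Ico 0 (2 * t))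
    (f := fun s => if s ∈ Finset.Ico 0 (2 * t) then thetaTerm (q ^ (1 + 2 * t * r)) q s else 0)
    (fun s hs => if_neg hs)
  have h3 := h2.add ((Equiv.subRight (2 * t)).hasSum_iff.2 h1)
  have h4 : ∑ s ∈ Finset.Ico 0 (2 * t), (if s ∈ Finset.Ico 0 (2 * t) then
      thetaTerm (q ^ (1 + 2 * t * r)) q s else 0) =
      ∑ s ∈ Finset.Ico 0 (2 * t), thetaTerm (q ^ (1 + 2 * t * r)) q s :=
    Finset.sum_congr rfl fun s hs => if_pos hs
  rw [h4] at h3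
  refine (h3.congr_fun fun s => ?_).tsum_eq
  simp only [Function.comp_apply, Equiv.subRight_apply, Finset.mem_Ico]
  rcases lt_trichotomy s 0 with h | h | h
  · rw [if_neg (by omega), if_neg (by omega), if_neg (by omega)]; simp
  · rw [if_pos (by omega), if_pos (by omega), if_neg (by omega)]; simp
  rcases lt_or_ge s (2 * t) with h' | h'
  · rw [if_pos (by omega), if_pos (by omega), if_neg (by omega)]; simp
  · rw [if_pos (by omega), if_neg (by omega), if_pos (by omega), zero_add, thetaTerm_zpow hq0,
      thetaTerm_zpow hq0, mul_left_comm, ← zpow_add₀ hq0,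
      show 2 * t ^ 2 + t + 4 * t ^ 2 * r + (binom2 (s - 2 * t) + (1 + 2 * t * (r + 1)) *
        (s - 2 * t)) = binom2 s + (1 + 2 * t * r) * s by
        linarith [two_mul_binom2 s, two_mul_binom2 (s - 2 * t)],
      zpow_sub₀ (show (-1 : ℂ) ≠ 0 by simp), zpow_mul (-1)]
    simp

/-- The partial theta series is bounded for `r ≥ 0` and, by reflection, decays like `q^(2t|r|)` for
`r < 0`. -/
theorem exists_norm_partialTheta_le {q : ℂ} (hq0 : q ≠ 0) (hq1 : ‖q‖ < 1) {t : ℤ} (ht : 1 ≤ t) :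
    ∃ C, 0 ≤ C ∧ ∀ r, ‖partialTheta t q r‖ ≤ C * ‖q‖ ^ (2 * t * max 0 (-r)) := by
  have hq' : 0 < ‖q‖ := norm_pos_iff.2 hq0
  have hs := (summable_thetaTerm_zpow hq0 hq1 1).norm
  have h (r : ℤ) (hr : 0 ≤ r) : ‖partialTheta t q r‖ ≤ ∑' s : ℤ, ‖thetaTerm (q ^ (1 : ℤ)) q s‖ := by
    refine tsum_of_norm_bounded hs.hasSum fun s => ?_
    split_ifs with h
    · simp only [thetaTerm_zpow hq0, norm_mul, norm_zpow, norm_neg, norm_one, one_zpow, one_mul]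
      refine zpow_le_zpow_right_of_le_one₀ hq' hq1.le ?_
      nlinarith [mul_nonneg (mul_nonneg (show 0 ≤ t by omega) hr) h]
    · simp
  refine ⟨∑' s : ℤ, ‖thetaTerm (q ^ (1 : ℤ)) q s‖, tsum_nonneg fun s => norm_nonneg _, fun r => ?_⟩
  rcases le_or_gt 0 r with hr | hr
  · simpa [max_eq_left (show -r ≤ 0 by omega)] using h r hr
  · rw [partialTheta_neg hq0 hq1, max_eq_right (by omega), norm_mul, norm_zpow, mul_comm,
      show -2 * t * r = 2 * t * -r by ring]
    gcongr
    exact h _ (by omega)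

theorem exists_norm_partialTheta_le' {q : ℂ} (hq0 : q ≠ 0) (hq1 : ‖q‖ < 1) {t : ℤ} (ht : 1 ≤ t) :
    ∃ C, ∀ r, ‖partialTheta t q r‖ ≤ C := by
  obtain ⟨C, hC0, hC⟩ := exists_norm_partialTheta_le hq0 hq1 ht
  refine ⟨C, fun r => (hC r).trans (mul_le_of_le_one_right hC0 ?_)⟩
  exact zpow_le_one₀ (norm_pos_iff.2 hq0) hq1.le (by positivity)

/-- The series `∑_r (-1)^r q^(r(r+1)/2 + ur) p(r)` with the partial theta series `p = partialTheta`;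
it is the Hecke-type double sum `f_{1,2t,1}(q^(1+u), q; q)` summed by rows. -/
noncomputable def rowSum (t : ℤ) (q : ℂ) (u : ℤ) : ℂ :=
  ∑' r : ℤ, thetaTerm (q ^ (1 + u)) q r * partialTheta t q r

theorem summable_rowSum {q : ℂ} (hq0 : q ≠ 0) (hq1 : ‖q‖ < 1) {t : ℤ} (ht : 1 ≤ t) (u : ℤ) :
    Summable fun r => thetaTerm (q ^ (1 + u)) q r * partialTheta t q r := by
  obtain ⟨C, hC⟩ := exists_norm_partialTheta_le' hq0 hq1 ht
  refine .of_norm_bounded ((summable_thetaTerm_zpow hq0 hq1 (1 + u)).norm.mul_right C) fun r => ?_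
  rw [norm_mul]
  gcongr
  exact hC r

theorem hasSum_heckeTerm_row {q : ℂ} (hq0 : q ≠ 0) (hq1 : ‖q‖ < 1) (t u r : ℤ) :
    HasSum (fun s => heckeTerm 1 (2 * t) 1 (q ^ (1 + u)) q q (r, s))
      (thetaTerm (q ^ (1 + u)) q r * partialTheta t q r) := by
  refine ((hasSum_sg_mul_thetaTerm hq0 hq1 t r).mul_left _).congr_fun fun s => ?_
  simp only [heckeTerm, thetaTerm, ← zpow_mul]
  simp only [one_mul, zpow_add₀ hq0, zpow_add₀ (show (-1 : ℂ) ≠ 0 by simp), add_mul]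
  rw [show 2 * t * r * s = r * (2 * t) * s by ring]
  ring

theorem heckeSum_eq_rowSum {q : ℂ} (hq0 : q ≠ 0) (hq1 : ‖q‖ < 1) {t : ℤ} (ht : 1 ≤ t) (u : ℤ) :
    heckeSum 1 (2 * t) 1 (q ^ (1 + u)) q q = rowSum t q u := by
  have hs := summable_heckeTerm (a := 1) (b := 2 * t) (c := 1) le_rfl (by omega) le_rfl hq0 hq1
    (zpow_ne_zero (1 + u) hq0) hq0
  rw [heckeSum, hs.tsum_prod]
  exact tsum_congr fun r => (hasSum_heckeTerm_row hq0 hq1 t u r).tsum_eq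

/-- The quasi-periodicity of `f_{1,2t,1}(q^(1+u), q; q)` in `u`, with period `4t² - 1`. The theta
series that usually appear as boundary terms vanish, because they are taken at powers of `q`. -/
theorem rowSum_add {q : ℂ} (hq0 : q ≠ 0) (hq1 : ‖q‖ < 1) {t : ℤ} (ht : 1 ≤ t) (u : ℤ) :
    rowSum t q u = -q ^ (t - 2 * t ^ 2 - u) * rowSum t q (u + (4 * t ^ 2 - 1)) := by
  have h1 := ((Equiv.addRight (1 : ℤ)).hasSum_iff.2
    (summable_rowSum hq0 hq1 ht (u + (4 * t ^ 2 - 1))).hasSum).mul_left (-q ^ (t - 2 * t ^ 2 - u))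
  have h2 := hasSum_sum (s := Finset.Ico 0 (2 * t)) fun s _ =>
    (hasSum_thetaTerm_zpow hq0 hq1 (1 + u + 2 * t * s)).mul_left (thetaTerm q q s)
  have h3 := h2.add h1
  simp only [mul_zero, Finset.sum_const_zero, zero_add] at h3
  refine (h3.congr_fun fun r => ?_).tsum_eq
  rw [partialTheta_add_one hq0 hq1 ht, mul_add, Finset.mul_sum]
  congr 1
  · refine Finset.sum_congr rfl fun s _ => ?_
    simp only [thetaTerm, ← zpow_mul]
    simp only [zpow_add₀ hq0, add_mul, one_mul]
    rw [show 2 * t * s * r = 2 * t * r * s by ring]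
    ring
  · simp only [Function.comp_apply, Equiv.coe_addRight, thetaTerm_zpow hq0]
    rw [← mul_assoc, ← mul_assoc, mul_assoc ((-1) ^ r), ← zpow_add₀ hq0, neg_mul, mul_left_comm,
      ← zpow_add₀ hq0, zpow_add_one₀ (show (-1 : ℂ) ≠ 0 by simp), binom2_add_one]
    rw [show binom2 r + (1 + u) * r + (2 * t ^ 2 + t + 4 * t ^ 2 * r) =
      t - 2 * t ^ 2 - u + (binom2 r + r + (1 + (u + (4 * t ^ 2 - 1))) * (r + 1)) by ring]
    ring

/-! ### The triple series -/

/-- Lower bound for the exponent of `q` in the triple series below. The quadratic form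
`(n + i)^2 + 2ir + r^2` degenerates along `n = 0`, `i = -r`, so the linear terms matter: `0 ≤ v`
controls `r ≥ 0`, and `v + 1 ≤ 2t`, together with the decay of the partial theta series, controls
`r < 0`. -/
theorem le_exponent {t v n i : ℤ} (hv : 0 ≤ v) (hv' : v + 1 ≤ 2 * t)
    (h : 0 ≤ n ∧ 0 ≤ i ∨ n < 0 ∧ i < 0) (r : ℤ) :
    4 * binom2 n + 2 * n + |i| + |r| ≤
      4 * (n + (binom2 (n + i) + i) + i * r + (binom2 r + (1 + v) * r) + 2 * t * max 0 (-r)) := by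
  have e1 := two_mul_binom2 n
  have e2 := two_mul_binom2 (n + i)
  have e3 := two_mul_binom2 r
  rcases h with ⟨hn, hi⟩ | ⟨hn, hi⟩ <;> rcases le_or_gt 0 r with hr | hr
  · rw [abs_of_nonneg hi, abs_of_nonneg hr, max_eq_left (by omega)]
    nlinarith [mul_nonneg hv hr, mul_nonneg hn hi, mul_nonneg hi hr, sq_nonneg i, sq_nonneg r]
  · rw [abs_of_nonneg hi, abs_of_neg hr, max_eq_right (by omega)]
    have hd : 0 ≤ binom2 (i + r + 1) := binom2_nonneg _
    nlinarith [two_mul_binom2 (i + r + 1), mul_nonneg hn hi, sq_nonneg (i + r),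
      mul_nonneg (show 0 ≤ 2 * t - v - 1 by omega) (show 0 ≤ -r by omega)]
  · rw [abs_of_neg hi, abs_of_nonneg hr, max_eq_left (by omega)]
    nlinarith [mul_nonneg hv hr, mul_nonneg (show 0 ≤ -n - 1 by omega) (show 0 ≤ -i - 1 by omega),
      sq_nonneg (i + r), binom2_nonneg (i + r), two_mul_binom2 (i + r), binom2_nonneg (i + r + 1),
      two_mul_binom2 (i + r + 1)]
  · rw [abs_of_neg hi, abs_of_neg hr, max_eq_right (by omega)]
    nlinarith [mul_nonneg (show 0 ≤ -n - 1 by omega) (show 0 ≤ -i - 1 by omega),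
      mul_nonneg (show 0 ≤ 2 * t - v - 1 by omega) (show 0 ≤ -r by omega),
      mul_nonneg (show 0 ≤ -r - 1 by omega) (show 0 ≤ -i - 1 by omega),
      mul_nonneg (show 0 ≤ -r - 1 by omega) (show 0 ≤ -r by omega),
      mul_nonneg (show 0 ≤ -i - 1 by omega) (show 0 ≤ -i by omega)]

theorem summable_pow_natAbs {Q : ℝ} (h0 : 0 ≤ Q) (h1 : Q < 1) :
    Summable fun n : ℤ => Q ^ n.natAbs :=
  .of_nat_of_neg (by simpa using summable_geometric_of_lt_one h0 h1)
    (by simpa using summable_geometric_of_lt_one h0 h1)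

/-- Absolute convergence of the triple series, by comparison with the product of a theta series in `n`
and geometric series in `|i|` and `|r|`. -/
theorem summable_triple {z q : ℂ} (hq0 : q ≠ 0) (hq1 : ‖q‖ < 1) (hz : z ≠ 0) {t v : ℤ}
    (ht : 1 ≤ t) (hv : 0 ≤ v) (hv' : v + 1 ≤ 2 * t) :
    Summable fun p : (ℤ × ℤ) × ℤ => heckeTerm 1 1 1 (z * q) q q p.1 * q ^ (p.1.2 * p.2) *
      (thetaTerm (q ^ (1 + v)) q p.2 * partialTheta t q p.2) := by
  obtain ⟨C, hC0, hC⟩ := exists_norm_partialTheta_le hq0 hq1 ht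
  have hq' : 0 < ‖q‖ := norm_pos_iff.2 hq0
  -- the fourth root absorbs the factor `4` of `le_exponent`
  obtain ⟨Q, hQ0, hQ⟩ : ∃ Q : ℝ, 0 < Q ∧ Q ^ 4 = ‖q‖ :=
    ⟨‖q‖ ^ (1 / 4 : ℝ), by positivity, by
      rw [← Real.rpow_natCast, ← Real.rpow_mul hq'.le]; norm_num⟩
  have hQ1 : Q < 1 := by
    by_contra! h
    exact absurd (one_le_pow₀ h (n := 4)) (by rw [hQ]; exact not_le.2 hq1)
  have hQz : (Q : ℂ) ≠ 0 := by exact_mod_cast hQ0.ne'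
  have hg := summable_pow_natAbs hQ0.le hQ1
  have hs := (((summable_thetaTerm hq0 hq1 (mul_ne_zero hz (pow_ne_zero 2 hQz))).norm.mul_of_nonneg
    hg (fun _ => norm_nonneg _) fun _ => by positivity).mul_of_nonneg hg
    (fun _ => by positivity) fun _ => by positivity).mul_left C
  refine .of_norm_bounded hs ?_
  rintro ⟨⟨n, i⟩, r⟩
  have key (h : 0 ≤ n ∧ 0 ≤ i ∨ n < 0 ∧ i < 0) :
      ‖(z * q) ^ n‖ * ‖q ^ i‖ * ‖q ^ binom2 (n + i)‖ * ‖q ^ (i * r)‖ *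
        (‖thetaTerm (q ^ (1 + v)) q r‖ * ‖partialTheta t q r‖) ≤
      C * (‖thetaTerm (z * (Q : ℂ) ^ 2) q n‖ * Q ^ i.natAbs * Q ^ r.natAbs) := by
    have hz' : 0 < ‖z‖ := norm_pos_iff.2 hz
    calc _ ≤ ‖(z * q) ^ n‖ * ‖q ^ i‖ * ‖q ^ binom2 (n + i)‖ * ‖q ^ (i * r)‖ *
          (‖thetaTerm (q ^ (1 + v)) q r‖ * (C * ‖q‖ ^ (2 * t * max 0 (-r)))) := by
            gcongr
            exact hC r
      _ = C * (‖z‖ ^ n * Q ^ (4 * (n + (binom2 (n + i) + i) + i * r + (binom2 r + (1 + v) * r) +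
          2 * t * max 0 (-r)))) := by
            simp only [thetaTerm_zpow hq0, norm_mul, norm_zpow, norm_neg, norm_one, one_zpow,
              mul_zpow, zpow_mul Q, zpow_ofNat, hQ, one_mul, zpow_add₀ hq'.ne']
            ring
      _ ≤ C * (‖z‖ ^ n * Q ^ (4 * binom2 n + 2 * n + |i| + |r|)) := by
            refine mul_le_mul_of_nonneg_left (mul_le_mul_of_nonneg_left
              (zpow_le_zpow_right_of_le_one₀ hQ0 hQ1.le (le_exponent hv hv' h r)) ?_) hC0
            positivity
      _ = _ := by
            simp only [Int.abs_eq_natAbs, zpow_add₀ hQ0.ne', zpow_natCast, zpow_mul Q, zpow_ofNat,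
              hQ, thetaTerm, norm_mul, norm_zpow, norm_neg, norm_one, one_zpow, one_mul, norm_pow,
              Complex.norm_real, Real.norm_of_nonneg hQ0.le, mul_zpow]
            ring
  rw [heckeTerm_one_one_one hq0, sg₂_eq]
  simp only [norm_mul, norm_neg_one_zpow, one_mul] at key ⊢
  split_ifs with h1 h2
  · simpa using key (.inl h1)
  · simpa using key (.inr h2)
  · simp only [Int.cast_zero, norm_zero, zero_mul]
    positivity

theorem tsum_triple_inner {q : ℂ} (hq0 : q ≠ 0) (t v i : ℤ) :
    ∑' r, q ^ (i * r) * (thetaTerm (q ^ (1 + v)) q r * partialTheta t q r) =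
      rowSum t q (v + i) := by
  refine tsum_congr fun r => ?_
  rw [thetaTerm_zpow hq0, thetaTerm_zpow hq0, ← mul_assoc, mul_left_comm, ← zpow_add₀ hq0]
  congr 3
  ring

theorem heckeTerm_mul_zpow {x q : ℂ} (hq0 : q ≠ 0) (p : ℤ × ℤ) (r : ℤ) :
    heckeTerm 1 1 1 x q q p * q ^ (p.2 * r) = heckeTerm 1 1 1 x (q ^ (r + 1)) q p := by
  have h : (q ^ (r + 1)) ^ p.2 = q ^ p.2 * q ^ (p.2 * r) := by
    rw [← zpow_mul, ← zpow_add₀ hq0]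
    congr 1
    ring
  simp only [heckeTerm, h]
  ring

theorem summable_heckeTerm_mul_rowSum {z q : ℂ} (hq0 : q ≠ 0) (hq1 : ‖q‖ < 1) (hz : z ≠ 0)
    {t v : ℤ} (ht : 1 ≤ t) (hv : 0 ≤ v) (hv' : v + 1 ≤ 2 * t) :
    Summable fun p : ℤ × ℤ => heckeTerm 1 1 1 (z * q) q q p * rowSum t q (v + p.2) := by
  refine (summable_triple hq0 hq1 hz ht hv hv').prod.congr fun p => ?_
  simp only [mul_assoc, tsum_mul_left, tsum_triple_inner hq0]

/-- The two ways of summing the triple series. -/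
theorem tsum_heckeTerm_mul_rowSum {z q : ℂ} (hq0 : q ≠ 0) (hq1 : ‖q‖ < 1) (hz : z ≠ 0)
    {t v : ℤ} (ht : 1 ≤ t) (hv : 0 ≤ v) (hv' : v + 1 ≤ 2 * t) :
    ∑' p : ℤ × ℤ, heckeTerm 1 1 1 (z * q) q q p * rowSum t q (v + p.2) =
      ∑' r, thetaTerm (q ^ (1 + v)) q r * partialTheta t q r *
        heckeSum 1 1 1 (z * q) (q ^ (r + 1)) q := by
  have hs := summable_triple hq0 hq1 hz ht hv hv'
  have h1 : ∀ p : ℤ × ℤ, heckeTerm 1 1 1 (z * q) q q p * rowSum t q (v + p.2) =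
      ∑' r, heckeTerm 1 1 1 (z * q) q q p * q ^ (p.2 * r) *
        (thetaTerm (q ^ (1 + v)) q r * partialTheta t q r) := fun p => by
    simp only [mul_assoc, tsum_mul_left, tsum_triple_inner hq0]
  simp only [h1]
  rw [← Summable.tsum_comm (f := fun (p : ℤ × ℤ) r => heckeTerm 1 1 1 (z * q) q q p *
    q ^ (p.2 * r) * (thetaTerm (q ^ (1 + v)) q r * partialTheta t q r)) hs]
  refine tsum_congr fun r => ?_
  rw [heckeSum, ← tsum_mul_left]
  exact tsum_congr fun p => by rw [heckeTerm_mul_zpow hq0, mul_comm]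

/-! ### The Hecke-Appell sum `h_{t,m}` -/

theorem exists_norm_inv_one_sub_le {x q : ℂ} (hq0 : q ≠ 0) (hq1 : ‖q‖ < 1) (hx0 : x ≠ 0) :
    ∃ D, ∀ r : ℤ, ‖(1 - x * q ^ r)⁻¹‖ ≤ D := by
  have hp := tendsto_pow_atTop_nhds_zero_of_norm_lt_one hq1
  have h1 : Tendsto (fun n : ℕ => (1 - x * q ^ n)⁻¹) atTop (𝓝 (1 - x * 0)⁻¹) :=
    ((hp.const_mul x).const_sub 1).inv₀ (by simp)
  have h2 : Tendsto (fun n : ℕ => q ^ n * (q ^ n - x)⁻¹) atTop (𝓝 (0 * (0 - x)⁻¹)) :=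
    hp.mul ((hp.sub_const x).inv₀ (by simpa using hx0))
  obtain ⟨C1, hC1⟩ := h1.norm.bddAbove_range
  obtain ⟨C2, hC2⟩ := h2.norm.bddAbove_range
  refine ⟨max C1 C2, fun r => ?_⟩
  obtain ⟨n, rfl | rfl⟩ := r.eq_nat_or_neg
  · rw [zpow_natCast]
    exact (hC1 ⟨n, rfl⟩).trans (le_max_left _ _)
  · refine le_trans (le_of_eq ?_) ((hC2 ⟨n, rfl⟩).trans (le_max_right _ _))
    have hqn : q ^ n ≠ 0 := pow_ne_zero n hq0
    dsimp only
    congr 1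
    rw [zpow_neg, zpow_natCast, show q ^ n - x = q ^ n * (1 - x * (q ^ n)⁻¹) by field_simp,
      mul_inv, mul_inv_cancel_left₀ hqn]

theorem hTerm_eq {q : ℂ} (hq0 : q ≠ 0) (t m : ℤ) (x : ℂ) (p : ℤ × ℤ) :
    hTerm t m x q p = (heckeTerm 1 (2 * t) 1 (q ^ (1 + (t - m))) q q p +
      heckeTerm 1 (2 * t) 1 (q ^ (1 + (t + m))) q q p) * (1 - x * q ^ p.1)⁻¹ := by
  obtain ⟨r, s⟩ := p
  simp only [hTerm, heckeTerm, ← zpow_mul, div_eq_mul_inv]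
  rw [← mul_assoc]
  congr 1
  have h2 : (q ^ ((1 + (t + m)) * r) : ℂ) = q ^ ((1 + (t - m)) * r) * q ^ (2 * m * r) := by
    rw [← zpow_add₀ hq0]; congr 1; ring
  have h1 : (q ^ (binom2 (r + 1) + 2 * t * r * s + binom2 (s + 1) + (t - m) * r) : ℂ) =
      q ^ ((1 + (t - m)) * r) * q ^ s * q ^ (1 * binom2 r + 2 * t * r * s + 1 * binom2 s) := by
    rw [← zpow_add₀ hq0, ← zpow_add₀ hq0, binom2_add_one, binom2_add_one]; congr 1; ring
  rw [h1, h2]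
  ring

theorem summable_hTerm {x q : ℂ} (hq0 : q ≠ 0) (hq1 : ‖q‖ < 1) (hx0 : x ≠ 0) {t : ℤ} (ht : 1 ≤ t)
    (m : ℤ) : Summable (hTerm t m x q) := by
  obtain ⟨D, hD⟩ := exists_norm_inv_one_sub_le hq0 hq1 hx0
  have hs (u : ℤ) := summable_heckeTerm (a := 1) (b := 2 * t) (c := 1) le_rfl (by omega) le_rfl
    hq0 hq1 (zpow_ne_zero (1 + u) hq0) hq0
  refine .of_norm_bounded (((hs (t - m)).add (hs (t + m))).norm.mul_right D) fun p => ?_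
  rw [hTerm_eq hq0, norm_mul]
  gcongr
  exact hD _

theorem summable_half {x q : ℂ} (hq0 : q ≠ 0) (hq1 : ‖q‖ < 1) (hx0 : x ≠ 0) {t : ℤ} (ht : 1 ≤ t)
    (u : ℤ) : Summable fun r => thetaTerm (q ^ (1 + u)) q r * partialTheta t q r *
      (1 - x * q ^ r)⁻¹ := by
  obtain ⟨D, hD⟩ := exists_norm_inv_one_sub_le hq0 hq1 hx0
  refine .of_norm_bounded ((summable_rowSum hq0 hq1 ht u).norm.mul_right D) fun r => ?_
  rw [norm_mul]
  gcongr
  exact hD _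

/-- The Hecke-Appell sum `h_{t,m}`, summed by rows. -/
theorem hSum_eq {x q : ℂ} (hq0 : q ≠ 0) (hq1 : ‖q‖ < 1) (hx0 : x ≠ 0) {t : ℤ} (ht : 1 ≤ t)
    (m : ℤ) : hSum t m x q =
      ∑' r, thetaTerm (q ^ (1 + (t - m))) q r * partialTheta t q r * (1 - x * q ^ r)⁻¹ +
      ∑' r, thetaTerm (q ^ (1 + (t + m))) q r * partialTheta t q r * (1 - x * q ^ r)⁻¹ := by
  rw [hSum, (summable_hTerm hq0 hq1 hx0 ht m).tsum_prod,
    ← (summable_half hq0 hq1 hx0 ht _).tsum_add (summable_half hq0 hq1 hx0 ht _)]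
  refine tsum_congr fun r => ?_
  simp only [hTerm_eq hq0, tsum_mul_right]
  rw [((hasSum_heckeTerm_row hq0 hq1 t (t - m) r).add
    (hasSum_heckeTerm_row hq0 hq1 t (t + m) r)).tsum_eq, add_mul]

/-- Replacing `x` by `x⁻¹` exchanges the two halves of `h_{t,m}`. -/
theorem tsum_half_inv {x q : ℂ} (hq0 : q ≠ 0) (hq1 : ‖q‖ < 1) (hx0 : x ≠ 0)
    (hx : ∀ n : ℤ, x ≠ q ^ n) (t m : ℤ) :
    ∑' r, thetaTerm (q ^ (1 + (t - m))) q r * partialTheta t q r *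
        (thetaSum x⁻¹ q / (1 - x⁻¹ * q ^ r)) =
      thetaSum x q * ∑' r, thetaTerm (q ^ (1 + (t + m))) q r * partialTheta t q r *
        (1 - x * q ^ r)⁻¹ := by
  rw [← (Equiv.neg ℤ).tsum_eq, ← tsum_mul_left]
  refine tsum_congr fun r => ?_
  rw [Equiv.neg_apply, partialTheta_neg hq0 hq1 t (-r), neg_neg, thetaSum_inv hq0 hx0]
  have h0 := one_sub_mul_zpow_ne_zero hx r
  have hr := zpow_ne_zero r hq0
  have h1 : -x⁻¹ * thetaSum x q / (1 - x⁻¹ * q ^ (-r)) =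
      thetaSum x q * q ^ r * (1 - x * q ^ r)⁻¹ := by
    have h2 : 1 - x⁻¹ * q ^ (-r) = -x⁻¹ * (q ^ r)⁻¹ * (1 - x * q ^ r) := by
      rw [zpow_neg]; field_simp; ring
    rw [h2]
    field_simp
  have h3 : thetaTerm (q ^ (1 + (t - m))) q (-r) * q ^ (-2 * t * -r) * q ^ r =
      thetaTerm (q ^ (1 + (t + m))) q r := by
    rw [thetaTerm_zpow hq0, thetaTerm_zpow hq0, mul_assoc, mul_assoc, ← zpow_add₀ hq0,
      ← zpow_add₀ hq0, zpow_neg, ← inv_zpow, inv_neg_one, binom2_neg]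
    congr 2
    ring
  rw [h1, ← h3]
  ring

/-- The product `Θ(x; q) h_{t,m}(x; q)` as a Laurent series in `x`, symmetric in `x` and `x⁻¹`. -/
theorem thetaSum_mul_hSum {x q : ℂ} (hq0 : q ≠ 0) (hq1 : ‖q‖ < 1) (hx0 : x ≠ 0)
    (hx : ∀ n : ℤ, x ≠ q ^ n) {t m : ℤ} (ht : 1 ≤ t) (hm1 : 1 - t ≤ m) (hm2 : m ≤ t) :
    thetaSum x q * hSum t m x q =
      ∑' p : ℤ × ℤ, heckeTerm 1 1 1 (x⁻¹ * q) q q p * rowSum t q (t - m + p.2) +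
      ∑' p : ℤ × ℤ, heckeTerm 1 1 1 (x * q) q q p * rowSum t q (t - m + p.2) := by
  have hx' : ∀ n : ℤ, x⁻¹ ≠ q ^ n := fun n h => hx (-n) (by rw [zpow_neg, ← h, inv_inv])
  rw [tsum_heckeTerm_mul_rowSum hq0 hq1 (inv_ne_zero hx0) ht (by omega) (by omega),
    tsum_heckeTerm_mul_rowSum hq0 hq1 hx0 ht (by omega) (by omega), hSum_eq hq0 hq1 hx0 ht, mul_add]
  congr 1
  · rw [← tsum_mul_left]
    refine tsum_congr fun r => ?_
    rw [heckeSum_one_one_one_zpow hq0 hq1 hx0 hx]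
    ring
  · rw [← tsum_half_inv hq0 hq1 hx0 hx]
    refine tsum_congr fun r => ?_
    have h := heckeSum_one_one_one_zpow hq0 hq1 (inv_ne_zero hx0) hx' r
    rw [inv_inv] at h
    rw [h]

/-! ### Regrouping modulo `4t² - 1` -/

/-- `∑_k ∑_{n,s} F(n, k + Ns) = ∑_{n,i} F(n, i)`, by division with remainder `i = k + Ns`. -/
theorem sum_tsum_add_mul {F : ℤ × ℤ → ℂ} (hF : Summable F) {N : ℤ} (hN : 0 < N) :
    ∑ k ∈ Finset.Icc 0 (N - 1), ∑' p : ℤ × ℤ, F (p.1, k + N * p.2) = ∑' p, F p := by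
  let e : Finset.Icc 0 (N - 1) × (ℤ × ℤ) ≃ ℤ × ℤ :=
    { toFun := fun a => (a.2.1, a.1 + N * a.2.2)
      invFun := fun p => (⟨p.2 % N, Finset.mem_Icc.2
        ⟨Int.emod_nonneg _ hN.ne', by have := Int.emod_lt_of_pos p.2 hN; omega⟩⟩, p.1, p.2 / N)
      left_inv := by
        rintro ⟨⟨k, hk⟩, n, s⟩
        rw [Finset.mem_Icc] at hk
        have h1 : (k + N * s) % N = k := by
          rw [Int.add_mul_emod_self_left, Int.emod_eq_of_lt hk.1 (by omega)]
        have h2 : (k + N * s) / N = s := by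
          rw [Int.add_mul_ediv_left _ _ hN.ne', Int.ediv_eq_zero_of_lt hk.1 (by omega), zero_add]
        simp [h1, h2]
      right_inv := fun p => Prod.ext rfl (Int.emod_add_mul_ediv p.2 N) }
  have hFe : Summable fun c => F (e c) := e.summable_iff.2 hF
  rw [← e.tsum_eq, hFe.tsum_prod, tsum_fintype, ← Finset.sum_coe_sort]
  rfl

/-- The quasi-periodicity `rowSum_add`, iterated `s` times for an arbitrary integer `s`. -/
theorem rowSum_eq_mul_add_mul {q : ℂ} (hq0 : q ≠ 0) (hq1 : ‖q‖ < 1) {t : ℤ} (ht : 1 ≤ t)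
    (u s : ℤ) : rowSum t q u =
      (-1) ^ s * q ^ ((t - 2 * t ^ 2 - u) * s - (4 * t ^ 2 - 1) * binom2 s) *
        rowSum t q (u + (4 * t ^ 2 - 1) * s) := by
  let f : ℤ → ℂ := fun s => (-1) ^ s *
    q ^ ((t - 2 * t ^ 2 - u) * s - (4 * t ^ 2 - 1) * binom2 s) *
      rowSum t q (u + (4 * t ^ 2 - 1) * s)
  -- both sides are values of `f`, which `rowSum_add` makes constant
  have hf : Function.Periodic f 1 := fun s => by
    simp only [f]
    rw [rowSum_add hq0 hq1 ht (u + (4 * t ^ 2 - 1) * s),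
      show u + (4 * t ^ 2 - 1) * s + (4 * t ^ 2 - 1) = u + (4 * t ^ 2 - 1) * (s + 1) by ring,
      show (t - 2 * t ^ 2 - u) * (s + 1) - (4 * t ^ 2 - 1) * binom2 (s + 1) =
        (t - 2 * t ^ 2 - u) * s - (4 * t ^ 2 - 1) * binom2 s +
          (t - 2 * t ^ 2 - (u + (4 * t ^ 2 - 1) * s)) by rw [binom2_add_one]; ring,
      zpow_add₀ hq0, zpow_add_one₀ (show (-1 : ℂ) ≠ 0 by simp)]
    ring
  have h := hf.int_mul s 0
  simpa [f, binom2] using h.symm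

/-- Termwise form of the regrouping: for `i = k + (4t² - 1)s` the quasi-periodicity trades
`G(t - m + i)` for `G(t - m + 1 - 4t² + k)`, and the factor gained turns `f_{1,1,1}` into
`f_{1,4t²-1,4t²(4t²-1)}`. -/
theorem heckeTerm_mul_rowSum_eq {z q : ℂ} (hq0 : q ≠ 0) (hq1 : ‖q‖ < 1) {t : ℤ} (ht : 1 ≤ t)
    (m : ℤ) {k : ℤ} (hk : k ∈ Finset.Icc 0 (4 * t ^ 2 - 1 - 1)) (n s : ℤ) :
    heckeTerm 1 1 1 (z * q) q q (n, k + (4 * t ^ 2 - 1) * s) *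
        rowSum t q (t - m + (k + (4 * t ^ 2 - 1) * s)) =
      q ^ (1 - m - 2 * t ^ 2) * ((-1) ^ (k + 1) * q ^ (binom2 (k + 1) + k) *
        rowSum t q (t - m + 1 - 4 * t ^ 2 + k)) *
      heckeTerm 1 (4 * t ^ 2 - 1) (4 * t ^ 2 * (4 * t ^ 2 - 1)) (z * q ^ (k + 1))
        (-q ^ (8 * t ^ 4 - m + 4 * t ^ 2 * k)) q (n, s) := by
  rw [Finset.mem_Icc] at hk
  -- as `0 ≤ k < 4t² - 1`, the index `k + (4t² - 1)s` has the sign of `s`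
  have hsg : sg₂ n (k + (4 * t ^ 2 - 1) * s) = sg₂ n s := by
    have h : 0 ≤ k + (4 * t ^ 2 - 1) * s ↔ 0 ≤ s := by
      constructor
      · intro h
        by_contra! hs
        nlinarith
      · intro hs
        have : 0 ≤ (4 * t ^ 2 - 1) * s := mul_nonneg (by nlinarith) hs
        omega
    simp only [sg₂, sg, h]
  -- `4t² - 1` is odd
  have hsign : ((-1) ^ (n + (k + (4 * t ^ 2 - 1) * s)) : ℂ) =
      (-1) ^ (k + 1) * (-1) ^ (s + 1) * (-1) ^ (n + s) * (-1) ^ s := by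
    rw [← zpow_add₀ (by simp), ← zpow_add₀ (by simp), ← zpow_add₀ (by simp),
      show k + 1 + (s + 1) + (n + s) + s =
        n + (k + (4 * t ^ 2 - 1) * s) + 2 * (1 + 2 * s - 2 * t ^ 2 * s) by ring,
      zpow_add₀ (by simp) _ (2 * _), zpow_mul]
    simp
  rw [heckeTerm_one_one_one hq0, rowSum_eq_mul_add_mul hq0 hq1 ht (t - m + 1 - 4 * t ^ 2 + k)
    (s + 1), show t - m + 1 - 4 * t ^ 2 + k + (4 * t ^ 2 - 1) * (s + 1) =
      t - m + (k + (4 * t ^ 2 - 1) * s) by ring, hsg, hsign, heckeTerm]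
  have hexp : (q ^ n * q ^ (k + (4 * t ^ 2 - 1) * s) *
      q ^ binom2 (n + (k + (4 * t ^ 2 - 1) * s)) : ℂ) =
      q ^ (1 - m - 2 * t ^ 2) * q ^ (binom2 (k + 1) + k) *
        q ^ ((t - 2 * t ^ 2 - (t - m + 1 - 4 * t ^ 2 + k)) * (s + 1) -
          (4 * t ^ 2 - 1) * binom2 (s + 1)) *
        q ^ ((k + 1) * n) * q ^ ((8 * t ^ 4 - m + 4 * t ^ 2 * k) * s) *
        q ^ (1 * binom2 n + (4 * t ^ 2 - 1) * n * s + 4 * t ^ 2 * (4 * t ^ 2 - 1) * binom2 s) := by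
    simp only [← zpow_add₀ hq0]
    congr 1
    rw [binom2_add_one s]
    apply mul_left_cancel₀ (two_ne_zero : (2 : ℤ) ≠ 0)
    linear_combination two_mul_binom2 (n + (k + (4 * t ^ 2 - 1) * s)) - two_mul_binom2 (k + 1) -
      two_mul_binom2 n - (4 * t ^ 2 - 1) ^ 2 * two_mul_binom2 s
  have hneg : ((-q ^ (8 * t ^ 4 - m + 4 * t ^ 2 * k)) ^ s : ℂ) =
      (-1) ^ s * q ^ ((8 * t ^ 4 - m + 4 * t ^ 2 * k) * s) := by
    rw [neg_eq_neg_one_mul, mul_zpow, ← zpow_mul]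
  rw [mul_zpow, mul_zpow, hneg, ← zpow_mul q (k + 1) n]
  linear_combination (sg₂ n s * ((-1) ^ (k + 1) * (-1) ^ (s + 1) * (-1) ^ (n + s) * (-1) ^ s) *
    z ^ n * rowSum t q (t - m + (k + (4 * t ^ 2 - 1) * s)) : ℂ) * hexp

theorem tsum_heckeTerm_mul_rowSum_eq_sum {z q : ℂ} (hq0 : q ≠ 0) (hq1 : ‖q‖ < 1) (hz : z ≠ 0)
    {t m : ℤ} (ht : 1 ≤ t) (hm1 : 1 - t ≤ m) (hm2 : m ≤ t) :
    ∑' p : ℤ × ℤ, heckeTerm 1 1 1 (z * q) q q p * rowSum t q (t - m + p.2) =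
      q ^ (1 - m - 2 * t ^ 2) * ∑ k ∈ Finset.Icc (0 : ℤ) (4 * t ^ 2 - 2),
        (-1) ^ (k + 1) * q ^ (binom2 (k + 1) + k) *
          heckeSum 1 (2 * t) 1 (q ^ (t - m + 2 - 4 * t ^ 2 + k)) q q *
          heckeSum 1 (4 * t ^ 2 - 1) (4 * t ^ 2 * (4 * t ^ 2 - 1)) (z * q ^ (k + 1))
            (-q ^ (8 * t ^ 4 - m + 4 * t ^ 2 * k)) q := by
  rw [← sum_tsum_add_mul (summable_heckeTerm_mul_rowSum hq0 hq1 hz ht (by omega) (by omega))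
    (show 0 < 4 * t ^ 2 - 1 by nlinarith), Finset.mul_sum,
    show 4 * t ^ 2 - 2 = 4 * t ^ 2 - 1 - 1 by ring]
  refine Finset.sum_congr rfl fun k hk => ?_
  simp only [heckeTerm_mul_rowSum_eq hq0 hq1 ht m hk]
  rw [tsum_mul_left, show t - m + 2 - 4 * t ^ 2 + k = 1 + (t - m + 1 - 4 * t ^ 2 + k) by ring,
    heckeSum_eq_rowSum hq0 hq1 ht, heckeSum]
  ring

end MixedFalseTheta

theorem theorem1p2 (q x : ℂ) (hq0 : q ≠ 0) (hq1 : ‖q‖ < 1)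
    (hx0 : x ≠ 0) (hx : ∀ n : ℤ, x ≠ q ^ n)
    (t m : ℤ) (ht : 1 ≤ t) (hm1 : 1 - t ≤ m) (hm2 : m ≤ t) :
    -- all the double series involved converge absolutely
    Summable (MixedFalseTheta.hTerm t m x q) ∧
    (∀ k ∈ Finset.Icc (0 : ℤ) (4 * t ^ 2 - 2),
      Summable (MixedFalseTheta.heckeTerm 1 (2 * t) 1 (q ^ (t - m + 2 - 4 * t ^ 2 + k)) q q) ∧
      Summable (MixedFalseTheta.heckeTerm 1 (4 * t ^ 2 - 1) (4 * t ^ 2 * (4 * t ^ 2 - 1))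
        (x⁻¹ * q ^ (k + 1)) (-q ^ (8 * t ^ 4 - m + 4 * t ^ 2 * k)) q) ∧
      Summable (MixedFalseTheta.heckeTerm 1 (4 * t ^ 2 - 1) (4 * t ^ 2 * (4 * t ^ 2 - 1))
        (x * q ^ (k + 1)) (-q ^ (8 * t ^ 4 - m + 4 * t ^ 2 * k)) q)) ∧
    MixedFalseTheta.W t m x q =
      (1 - x) * q ^ (1 - m - 2 * t ^ 2) / MixedFalseTheta.qPochInf q q ^ 2 *
        ∑ k ∈ Finset.Icc (0 : ℤ) (4 * t ^ 2 - 2),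
          (-1) ^ (k + 1) * q ^ (MixedFalseTheta.binom2 (k + 1) + k) *
            MixedFalseTheta.heckeSum 1 (2 * t) 1 (q ^ (t - m + 2 - 4 * t ^ 2 + k)) q q *
            (1 / MixedFalseTheta.Theta x q *
                MixedFalseTheta.heckeSum 1 (4 * t ^ 2 - 1) (4 * t ^ 2 * (4 * t ^ 2 - 1))
                  (x⁻¹ * q ^ (k + 1)) (-q ^ (8 * t ^ 4 - m + 4 * t ^ 2 * k)) q -
              x⁻¹ / MixedFalseTheta.Theta x⁻¹ q *
                MixedFalseTheta.heckeSum 1 (4 * t ^ 2 - 1) (4 * t ^ 2 * (4 * t ^ 2 - 1))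
                  (x * q ^ (k + 1)) (-q ^ (8 * t ^ 4 - m + 4 * t ^ 2 * k)) q) -
      1 / (MixedFalseTheta.qPochInf (x * q) q * MixedFalseTheta.qPochInf (q / x) q) := by
  have hhecke : ∀ k ∈ Finset.Icc (0 : ℤ) (4 * t ^ 2 - 2),
      Summable (MixedFalseTheta.heckeTerm 1 (2 * t) 1 (q ^ (t - m + 2 - 4 * t ^ 2 + k)) q q) ∧
      Summable (MixedFalseTheta.heckeTerm 1 (4 * t ^ 2 - 1) (4 * t ^ 2 * (4 * t ^ 2 - 1))
        (x⁻¹ * q ^ (k + 1)) (-q ^ (8 * t ^ 4 - m + 4 * t ^ 2 * k)) q) ∧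
      Summable (MixedFalseTheta.heckeTerm 1 (4 * t ^ 2 - 1) (4 * t ^ 2 * (4 * t ^ 2 - 1))
        (x * q ^ (k + 1)) (-q ^ (8 * t ^ 4 - m + 4 * t ^ 2 * k)) q) := fun k _ =>
    have hN : 1 ≤ 4 * t ^ 2 - 1 := by nlinarith
    have hc : 1 ≤ 4 * t ^ 2 * (4 * t ^ 2 - 1) := by nlinarith
    have hy := neg_ne_zero.2 (zpow_ne_zero (8 * t ^ 4 - m + 4 * t ^ 2 * k) hq0)
    have hk := zpow_ne_zero (k + 1) hq0
    ⟨MixedFalseTheta.summable_heckeTerm le_rfl (by omega) le_rfl hq0 hq1 (zpow_ne_zero _ hq0) hq0,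
      MixedFalseTheta.summable_heckeTerm le_rfl (by omega) hc hq0 hq1
        (mul_ne_zero (inv_ne_zero hx0) hk) hy,
      MixedFalseTheta.summable_heckeTerm le_rfl (by omega) hc hq0 hq1 (mul_ne_zero hx0 hk) hy⟩
  refine ⟨MixedFalseTheta.summable_hTerm hq0 hq1 hx0 ht m, hhecke, ?_⟩
  have hΘ := MixedFalseTheta.theta_ne_zero hq0 hq1 hx0 hx
  have h := MixedFalseTheta.thetaSum_mul_hSum hq0 hq1 hx0 hx ht hm1 hm2
  rw [MixedFalseTheta.tsum_heckeTerm_mul_rowSum_eq_sum hq0 hq1 (inv_ne_zero hx0) ht hm1 hm2,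
    MixedFalseTheta.tsum_heckeTerm_mul_rowSum_eq_sum hq0 hq1 hx0 ht hm1 hm2, ← mul_add,
    ← Finset.sum_add_distrib] at h
  rw [MixedFalseTheta.theta_eq_thetaSum hq0 hq1 hx0] at hΘ ⊢
  have hinv : x⁻¹ / MixedFalseTheta.Theta x⁻¹ q = -(1 / MixedFalseTheta.thetaSum x q) := by
    rw [MixedFalseTheta.theta_eq_thetaSum hq0 hq1 (inv_ne_zero hx0),
      MixedFalseTheta.thetaSum_inv hq0 hx0]
    field_simp
  simp only [hinv]
  rw [MixedFalseTheta.W, ← mul_div_cancel_left₀ (MixedFalseTheta.hSum t m x q) hΘ, h]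
  congr 1
  rw [mul_div_assoc, ← mul_assoc, ← mul_div_right_comm, Finset.sum_div]
  congr 1
  refine Finset.sum_congr rfl fun k _ => ?_
  ring
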